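/- Let $\gamma\in\mathbb{R}^n$, $\delta_1,\dots,\delta_n\in\mathbb{R}^d$, and for a portfolio $x\in\Delta_n=\{x\in\mathbb{R}^n: x\ge 0,\ \sum_i x_i=1\}$ let $\ell_x(z)=\sum_{i=1}^n x_i(\gamma_i+\delta_i^\top z)$, $z\in\mathbb{R}^d$. Let $\phi:(0,\infty)\to\mathbb{R}$ be convex with $\phi(1)=0$, and put $\phi(0)=\lim_{t\downarrow 0}\phi(t)\in(-\infty,+\infty]$. For a probability measure $\widehat{\mathbb{P}}$ on $\mathbb{R}^d$ and $\rho>0$ let $$\mathcal{P}_\rho=\Bigl\{\mathbb{Q}\ \text{probability measure}:\ \mathbb{Q}\ll\widehat{\mathbb{P}},\ D_\phi(\mathbb{Q}\,\|\,\widehat{\mathbb{P}})=\mathbb{E}_{\widehat{\mathbb{P}}}\bigl[\phi\bigl(\tfrac{d\mathbb{Q}}{d\widehat{\mathbb{P}}}\bigr)\bigr]\le\rho\Bigr\}.$$ Let $\phi^\star(s)=\sup_{t\ge 0}\{st-\phi(t)\}$ be the convex conjugate, and read $\eta\,\phi^\star(s/\eta)$ at $\eta=0$ as its limit as $\eta\downarrow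 0$, that is, $0$ if $s\le 0$ and $+\infty$ if $s>0$. Expectations are extended-real valued. (i) For every $x\in\Delta_n$ such that $\ell_x$ is $\widehat{\mathbb{P}}$-integrable, $$\inf_{\mathbb{Q}\in\mathcal{P}_\rho}\mathbb{E}_{\mathbb{Q}}[\ell_x(z)]=\max_{\eta\ge 0,\ \nu\in\mathbb{R}}\Bigl\{\nu-\rho\eta-\mathbb{E}_{\widehat{\mathbb{P}}}\Bigl[\eta\,\phi^\star\Bigl(\frac{\nu-\ell_x(z)}{\eta}\Bigr)\Bigr]\Bigr\},$$ as an equality in $[-\infty,+\infty]$, and the maximum is attained. (ii) Suppose that $\widehat{\mathbb{P}}$ puts mass $1/M$ on each of the points $z_1,\dots,z_M$, $M>0$, and let $K=\{(s,\eta,a)\in\mathbb{R}^3:\eta\ge 0,\ \eta\,\phi^\star(s/\eta)\le a\}$, a closed convex cone. Then for every $x\in\Delta_n$ the dual objective is $\nu-\rho\eta-\frac1M\sum_{m=1}^M\eta\,\phi^\star((\nu-\ell_x(z_m))/\eta)$, and the worst-case expectation is the attained optimal value of the finite-dimensional conic program $$\max_{\eta,\nu\in\mathbb{R},\ u\in\mathbb{R}^M}\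 \nu-\rho\eta-\frac1M\sum_{m=1}^M u_m\quad\text{s.t.}\quad(\nu-\ell_x(z_m),\,\eta,\,u_m)\in K,\quad m=1,\dots,M.$$ Its decision variables are the two scalars $(\eta,\nu)$ and the epigraph variables $u_m$; for fixed $\eta\ge 0$ and $\nu$, the supremum over $u$ is the dual objective at $(\eta,\nu)$. Consequently $\sup_{x\in\Delta_n}\inf_{\mathbb{Q}\in\mathcal{P}_\rho}\mathbb{E}_{\mathbb{Q}}[\ell_x(z)]$ is the optimal value of the conic program in $(x,\eta,\nu,u)$ with the same objective and constraints, together with $x\ge 0$ and $\sum_i x_i=1$. -/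

import Mathlib

open MeasureTheory Filter Topology
open scoped ENNReal

noncomputable section

/-! ### Extended expectations -/

/-- The expectation `∫ f⁺ dμ - ∫ f⁻ dμ` of an extended-real function, as an extended real number.
It is the Bochner integral when `f` is real and integrable, `+∞` (`-∞`) when only the positive
(negative) part has an infinite integral, and `⊥` when both parts have an infinite integral. -/
def eExp {Z : Type*} [MeasurableSpace Z] (μ : Measure Z) (f : Z → EReal) : EReal :=
  ((∫⁻ z, (f z).toENNReal ∂μ : ℝ≥0∞) : EReal) - ((∫⁻ z, (-f z).toENNReal ∂μ : ℝ≥0∞) : EReal)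

/-! ### Divergences -/

/-- A convex divergence generator: a finite convex function on `(0, ∞)` that vanishes at `1`.
Its values outside `(0, ∞)` are never used. -/
structure IsDivergenceGenerator (φ : ℝ → ℝ) : Prop where
  convexOn : ConvexOn ℝ (Set.Ioi 0) φ
  one : φ 1 = 0

/-- The extension of a generator to the line: `φ(0) = lim_{t ↓ 0} φ(t)`, which may be `+∞`
(for a convex `φ` the limit exists, so that it is the upper limit), and `φ = +∞` on `(-∞, 0)`. -/
def genExt (φ : ℝ → ℝ) (t : ℝ) : EReal :=
  if 0 < t then (φ t : EReal)
  else if t = 0 then limsup (fun s : ℝ => (φ s : EReal)) (𝓝[>] (0 : ℝ))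
  else ⊤

/-- The divergence `D_φ(Q ‖ P) = ∫ φ(dQ/dP) dP` (used for `Q ≪ P`). -/
def phiDiv {Z : Type*} [MeasurableSpace Z] (φ : ℝ → ℝ) (Q P : Measure Z) : EReal :=
  eExp P (fun z => genExt φ ((Q.rnDeriv P z).toReal))

/-- The ball of the probability measures `Q ≪ P` with `D_φ(Q ‖ P) ≤ ρ`. -/
def phiBall {Z : Type*} [MeasurableSpace Z] (φ : ℝ → ℝ) (P : Measure Z) (ρ : ℝ) :
    Set (Measure Z) :=
  {Q | IsProbabilityMeasure Q ∧ Q ≪ P ∧ phiDiv φ Q P ≤ (ρ : EReal)}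

/-- The worst-case (smallest) expectation of `f` over the ball. -/
def worstCase {Z : Type*} [MeasurableSpace Z] (φ : ℝ → ℝ) (P : Measure Z) (ρ : ℝ) (f : Z → ℝ) :
    EReal :=
  ⨅ Q ∈ phiBall φ P ρ, eExp Q (fun z => (f z : EReal))

/-! ### Conjugates and the dual objective -/

/-- The convex conjugate `φ⋆(s) = sup_{t ≥ 0} (s t - φ(t))`. -/
def phiConj (φ : ℝ → ℝ) (s : ℝ) : EReal :=
  ⨆ (t : ℝ) (_ : 0 ≤ t), ((s * t : ℝ) : EReal) - genExt φ t

/-- The (closed) perspective `η φ⋆(s / η)` of the conjugate, for `η ≥ 0`. At `η = 0` it is the limit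
as `η ↓ 0`: zero for `s ≤ 0` and `+∞` for `s > 0`. -/
def conjPersp (φ : ℝ → ℝ) (η s : ℝ) : EReal :=
  if η = 0 then (if s ≤ 0 then 0 else ⊤) else (η : EReal) * phiConj φ (s / η)

/-- The dual objective `ν - ρ η - E_P[η φ⋆((ν - f) / η)]`. -/
def dualObj {Z : Type*} [MeasurableSpace Z] (φ : ℝ → ℝ) (P : Measure Z) (ρ : ℝ) (f : Z → ℝ)
    (η ν : ℝ) : EReal :=
  ((ν - ρ * η : ℝ) : EReal) - eExp P (fun z => conjPersp φ η (ν - f z))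

/-! ### The loss and the empirical law -/

/-- The linear loss `ℓ_x(z) = ∑ i, x_i (γ_i + δ_i z)` of the portfolio `x`. -/
def linLoss {n d : ℕ} (γ : Fin n → ℝ) (δ : Fin n → EuclideanSpace ℝ (Fin d)) (x : Fin n → ℝ)
    (z : EuclideanSpace ℝ (Fin d)) : ℝ :=
  ∑ i, x i * (γ i + inner ℝ (δ i) z)

/-- The law that gives mass `1 / M` to each of the points `z_1, …, z_M`. -/
def empLaw {Z : Type*} [MeasurableSpace Z] {M : ℕ} (z : Fin M → Z) : Measure Z :=
  (M : ℝ≥0∞)⁻¹ • ∑ m, Measure.dirac (z m)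

/-! ### Conic programs -/

/-- A finite-dimensional conic program: maximize a linear functional `obj y` over the `y ∈ V` with
`A y + b ∈ K`, where `A` is linear and `K` is a closed convex cone. -/
structure ConicProgram (V W : Type*) [AddCommGroup V] [Module ℝ V] [FiniteDimensional ℝ V]
    [NormedAddCommGroup W] [NormedSpace ℝ W] [FiniteDimensional ℝ W] where
  obj : V →ₗ[ℝ] ℝ
  A : V →ₗ[ℝ] W
  b : W
  K : ProperCone ℝ W

namespace ConicProgram

variable {V W : Type*} [AddCommGroup V] [Module ℝ V] [FiniteDimensional ℝ V]
    [NormedAddCommGroup W] [NormedSpace ℝ W] [FiniteDimensional ℝ W]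

/-- The feasible set of a conic program. -/
def feasible (C : ConicProgram V W) : Set V := {y | C.A y + C.b ∈ C.K}

/-- The optimal value of a conic program (`⊥` if it is infeasible). -/
def value (C : ConicProgram V W) : EReal := ⨆ y ∈ C.feasible, (C.obj y : EReal)

end ConicProgram

/-! ### The cone of a generator -/

theorem le_phiConj (φ : ℝ → ℝ) (s t : ℝ) (ht : 0 < t) :
    ((s * t - φ t : ℝ) : EReal) ≤ phiConj φ s := by
  unfold phiConj
  refine le_iSup₂_of_le t ht.le ?_
  simp [genExt, ht]

theorem phiConj_le_iff (φ : ℝ → ℝ) (s c : ℝ) :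
    phiConj φ s ≤ (c : EReal) ↔ ∀ t : ℝ, 0 < t → s * t - φ t ≤ c := by
  constructor
  · intro h t ht
    exact_mod_cast (le_phiConj φ s t ht).trans h
  · intro h
    refine iSup₂_le fun t ht => ?_
    rcases ht.lt_or_eq with ht | rfl
    · simpa [genExt, ht] using (by exact_mod_cast h t ht : ((s * t - φ t : ℝ) : EReal) ≤ c)
    · have h1 : Tendsto (fun r : ℝ => ((s * r - c : ℝ) : EReal)) (𝓝[>] (0 : ℝ))
          (𝓝 ((-c : ℝ) : EReal)) := by
        refine (continuous_coe_real_ereal.tendsto _).comp ?_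
        have : Tendsto (fun r : ℝ => s * r - c) (𝓝 0) (𝓝 (s * 0 - c)) :=
          Continuous.tendsto (by fun_prop) 0
        simpa using this.mono_left nhdsWithin_le_nhds
      have h2 : ((-c : ℝ) : EReal) ≤ genExt φ 0 := by
        rw [← h1.limsup_eq]
        simp only [genExt, lt_irrefl, if_false, if_true]
        refine limsup_le_limsup ?_
        filter_upwards [self_mem_nhdsWithin] with r hr
        have := h r hr
        exact_mod_cast (by linarith : s * r - c ≤ φ r)
      have h3 : -genExt φ 0 ≤ (c : EReal) := by
        rw [EReal.neg_le]
        simpa using h2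
      simpa [sub_eq_add_neg] using h3

theorem conjPersp_le_iff (φ : ℝ → ℝ) (η s a : ℝ) (hη : 0 ≤ η) :
    conjPersp φ η s ≤ (a : EReal) ↔ ∀ t : ℝ, 0 < t → s * t - η * φ t ≤ a := by
  rcases hη.lt_or_eq with hη | rfl
  · have h0 : conjPersp φ η s ≤ (a : EReal) ↔ phiConj φ (s / η) ≤ ((a / η : ℝ) : EReal) := by
      rw [conjPersp, if_neg hη.ne', EReal.coe_div,
        EReal.le_div_iff_mul_le (by exact_mod_cast hη) (EReal.coe_ne_top _), mul_comm]
    rw [h0, phiConj_le_iff]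
    refine forall₂_congr fun t _ => ?_
    rw [le_div_iff₀ hη]
    have : (s / η * t - φ t) * η = s * t - η * φ t := by field_simp
    rw [this]
  · by_cases hs : s ≤ 0
    · simp only [conjPersp, if_true, hs, zero_mul, sub_zero]
      constructor
      · intro h t ht
        have h' : (0 : ℝ) ≤ a := by exact_mod_cast h
        nlinarith
      · intro h
        have : (0 : ℝ) ≤ a := by
          by_contra! ha
          rcases hs.lt_or_eq with hs | rfl
          · have := h (a / (2 * s)) (div_pos_of_neg_of_neg ha (by linarith))
            rw [mul_div_assoc', div_le_iff_of_neg (by linarith)] at this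
            nlinarith
          · have := h 1 one_pos
            linarith
        exact_mod_cast this
    · simp only [conjPersp, if_true, hs, if_false, zero_mul, sub_zero, top_le_iff,
        EReal.coe_ne_top, false_iff, not_forall, not_le]
      push Not at hs
      refine ⟨(|a| + 1) / s, by positivity, ?_⟩
      rw [mul_div_cancel₀ _ hs.ne']
      linarith [le_abs_self a]

/-- The closed convex cone `{(s, η, a) : η ≥ 0, η φ⋆(s / η) ≤ a}` in `ℝ³`, the epigraph of the
perspective of the conjugate. -/
def conjCone (φ : ℝ → ℝ) : ProperCone ℝ (ℝ × ℝ × ℝ) where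
  carrier := {p | 0 ≤ p.2.1 ∧ conjPersp φ p.2.1 p.1 ≤ (p.2.2 : EReal)}
  add_mem' := by
    rintro ⟨s, η, a⟩ ⟨s', η', a'⟩ ⟨h1, h2⟩ ⟨h1', h2'⟩
    refine ⟨add_nonneg h1 h1', ?_⟩
    change conjPersp φ (η + η') (s + s') ≤ ((a + a' : ℝ) : EReal)
    rw [conjPersp_le_iff _ _ _ _ (add_nonneg h1 h1')]
    rw [conjPersp_le_iff _ _ _ _ h1] at h2
    rw [conjPersp_le_iff _ _ _ _ h1'] at h2'
    intro t ht
    have := h2 t ht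
    have := h2' t ht
    simp only at *
    linarith
  zero_mem' := by simp [conjPersp]
  smul_mem' := by
    rintro ⟨c, hc⟩ ⟨s, η, a⟩ ⟨h1, h2⟩
    have h3 : (0 : ℝ) ≤ c * η := mul_nonneg hc h1
    refine ⟨h3, ?_⟩
    change conjPersp φ (c * η) (c * s) ≤ ((c * a : ℝ) : EReal)
    rw [conjPersp_le_iff _ _ _ _ h3]
    rw [conjPersp_le_iff _ _ _ _ h1] at h2
    intro t ht
    have := mul_le_mul_of_nonneg_left (h2 t ht) hc
    simp only at this
    linarith
  isClosed' := by
    have : {p : ℝ × ℝ × ℝ | 0 ≤ p.2.1 ∧ conjPersp φ p.2.1 p.1 ≤ (p.2.2 : EReal)} =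
        {p | 0 ≤ p.2.1} ∩ ⋂ t : ℝ, ⋂ _ : 0 < t, {p | p.1 * t - p.2.1 * φ t ≤ p.2.2} := by
      ext p
      simp only [Set.mem_ofPred_eq, Set.mem_inter_iff, Set.mem_iInter]
      exact and_congr_right fun h => conjPersp_le_iff _ _ _ _ h
    change IsClosed {p : ℝ × ℝ × ℝ | 0 ≤ p.2.1 ∧ conjPersp φ p.2.1 p.1 ≤ (p.2.2 : EReal)}
    rw [this]
    refine (isClosed_le (by fun_prop) (by fun_prop)).inter ?_
    exact isClosed_iInter fun t => isClosed_iInter fun _ =>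
      isClosed_le (by fun_prop) (by fun_prop)

/-- The product of `M` copies of the cone of `φ`. -/
def conjConePow (φ : ℝ → ℝ) (M : ℕ) : ProperCone ℝ (Fin M → ℝ × ℝ × ℝ) where
  carrier := {p | ∀ m, p m ∈ conjCone φ}
  add_mem' := fun h h' m => add_mem (h m) (h' m)
  zero_mem' := fun _ => zero_mem _
  smul_mem' := fun c _ h m => (conjCone φ).smul_mem (h m) c.2
  isClosed' := by
    simp only [Set.ofPred_forall]
    exact isClosed_iInter fun m => (conjCone φ).isClosed.preimage (continuous_apply m)

/-- The closed convex cone `ℝⁿ_{≥ 0} × {0} × K^M` with `K` the cone of `φ`. -/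
def portfolioCone (φ : ℝ → ℝ) (n M : ℕ) :
    ProperCone ℝ ((Fin n → ℝ) × ℝ × (Fin M → ℝ × ℝ × ℝ)) where
  carrier := {p | (∀ i, 0 ≤ p.1 i) ∧ p.2.1 = 0 ∧ p.2.2 ∈ conjConePow φ M}
  add_mem' := fun h h' =>
    ⟨fun i => add_nonneg (h.1 i) (h'.1 i), by simp [h.2.1, h'.2.1], add_mem h.2.2 h'.2.2⟩
  zero_mem' := ⟨fun _ => le_rfl, rfl, zero_mem _⟩
  smul_mem' := fun c p h =>
    ⟨fun i => mul_nonneg c.2 (h.1 i),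
      (by rw [Prod.smul_snd, Prod.smul_fst, h.2.1, smul_zero]),
      (conjConePow φ M).smul_mem h.2.2 c.2⟩
  isClosed' := by
    simp only [Set.ofPred_and, Set.ofPred_forall]
    refine (isClosed_iInter fun i => isClosed_le (by fun_prop) (by fun_prop)).inter
      ((isClosed_eq (by fun_prop) (by fun_prop)).inter ?_)
    exact (conjConePow φ M).isClosed.preimage (by fun_prop)

/-! ### The conic reformulations for an empirical law -/

/-- The conic program for a fixed portfolio with scenario losses `f 1, …, f M`. The decision
variables are the two scalars `η, ν` and the epigraph variables `u 1, …, u M`: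
maximize `ν - ρ η - (1 / M) ∑ u_m` subject to `(ν - f_m, η, u_m) ∈ K` for all `m`,
where `K` is the cone of `φ`. -/
def dualConic (φ : ℝ → ℝ) (ρ : ℝ) {M : ℕ} (f : Fin M → ℝ) :
    ConicProgram (ℝ × ℝ × (Fin M → ℝ)) (Fin M → ℝ × ℝ × ℝ) where
  obj :=
    { toFun := fun y => y.2.1 - ρ * y.1 - (M : ℝ)⁻¹ * ∑ m, y.2.2 m
      map_add' := fun y y' => by simp [Finset.sum_add_distrib]; ring
      map_smul' := fun c y => by simp [← Finset.mul_sum]; ring }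
  A :=
    { toFun := fun y m => (y.2.1, y.1, y.2.2 m)
      map_add' := fun _ _ => rfl
      map_smul' := fun _ _ => rfl }
  b := fun m => (-f m, 0, 0)
  K := conjConePow φ M

/-- The conic program for the robust portfolio problem. The decision variables are the portfolio
`x ∈ ℝⁿ`, the two scalars `η, ν` and the epigraph variables `u 1, …, u M`:
maximize `ν - ρ η - (1 / M) ∑ u_m` subject to `x ≥ 0`, `∑ x_i = 1` and
`(ν - ℓ_x(z_m), η, u_m) ∈ K` for all `m`, where `K` is the cone of `φ`. -/
def portfolioConic {n d M : ℕ} (γ : Fin n → ℝ) (δ : Fin n → EuclideanSpace ℝ (Fin d))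
    (φ : ℝ → ℝ) (ρ : ℝ) (z : Fin M → EuclideanSpace ℝ (Fin d)) :
    ConicProgram ((Fin n → ℝ) × ℝ × ℝ × (Fin M → ℝ))
      ((Fin n → ℝ) × ℝ × (Fin M → ℝ × ℝ × ℝ)) where
  obj :=
    { toFun := fun y => y.2.2.1 - ρ * y.2.1 - (M : ℝ)⁻¹ * ∑ m, y.2.2.2 m
      map_add' := fun y y' => by simp [Finset.sum_add_distrib]; ring
      map_smul' := fun c y => by simp [← Finset.mul_sum]; ring }
  A :=
    { toFun := fun y =>
        (y.1, ∑ i, y.1 i, fun m => (y.2.2.1 - linLoss γ δ y.1 (z m), y.2.1, y.2.2.2 m))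
      map_add' := fun y y' => by
        ext <;> simp [linLoss, Finset.sum_add_distrib, add_mul]
        ring
      map_smul' := fun c y => by
        ext <;> simp [linLoss, Finset.mul_sum, mul_assoc, mul_sub] }
  b := (0, -1, 0)
  K := portfolioCone φ n M

end

/-!
The duality is Lagrangian duality for the two constraints `E q = 1` and `E φ(q) ≤ ρ` on the density
`q = dQ/dP`, with multipliers `ν` and `η`.

Weak duality is the Fenchel inequality `(ν - f) q ≤ η φ⋆((ν - f) / η) + η φ(q)` integrated against
`P` (`mul_le_conjPersp_add`, `dualObj_le_worstCase`). A finite dual value and a finite divergence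
make both terms on the right integrable, since each is bounded below by an integrable function.

For the converse it is enough to test the primal problem on densities bounded away from `0` and
`∞`, for which every integral is finite. The triples `(a, b, c)` with `a = E q`, `b > E φ(q)` and
`c > E f q` form a convex set, which is open because `s ↦ E φ(s q)` is convex, hence continuous.
When the worst case is a real number `v`, the point `(1, ρ, v)` lies outside this set, and a
separating functional gives multipliers (`exists_multipliers`); the density `1` is a Slater point
because `φ(1) = 0 < ρ`. Finally the supremum over test densities of `E[(ν - f) q - η φ(q)]` is at
least `E[η φ⋆((ν - f) / η)]`: choose `q` as a running pointwise maximizer over a dense sequence and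
use monotone convergence (`eExp_conjPersp_le`).

For an empirical law the expectations are finite sums of terms different from `-∞`, and the
epigraph variables are eliminated by taking `u_m` equal to the perspective at the `m`-th scenario.
The worst case is then at least the smallest scenario loss, so that it is finite and the optimal
multipliers give a feasible point of the conic program.
-/

/-! ### Extended expectations -/

section Expectation

variable {Z : Type*} [MeasurableSpace Z] {μ : Measure Z}

theorem EReal.toENNReal_coe_real (x : ℝ) : (x : EReal).toENNReal = ENNReal.ofReal x := by
  rw [EReal.toENNReal_of_ne_top (EReal.coe_ne_top x), EReal.toReal_coe]

theorem eExp_mono_ae {f g : Z → EReal} (h : ∀ᵐ z ∂μ, f z ≤ g z) : eExp μ f ≤ eExp μ g := by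
  refine EReal.sub_le_sub ?_ ?_
  · refine EReal.coe_ennreal_le_coe_ennreal_iff.2 (lintegral_mono_ae ?_)
    filter_upwards [h] with z hz using EReal.toENNReal_le_toENNReal hz
  · refine EReal.coe_ennreal_le_coe_ennreal_iff.2 (lintegral_mono_ae ?_)
    filter_upwards [h] with z hz using EReal.toENNReal_le_toENNReal (EReal.neg_le_neg_iff.2 hz)

theorem eExp_congr_ae {f g : Z → EReal} (h : ∀ᵐ z ∂μ, f z = g z) : eExp μ f = eExp μ g :=
  le_antisymm (eExp_mono_ae (h.mono fun _ hz => hz.le)) (eExp_mono_ae (h.mono fun _ hz => hz.ge))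

theorem eExp_coe_of_integrable {f : Z → ℝ} (hf : Integrable f μ) :
    eExp μ (fun z => (f z : EReal)) = ((∫ z, f z ∂μ : ℝ) : EReal) := by
  have h1 : ∫⁻ z, ENNReal.ofReal (f z) ∂μ ≠ ⊤ := hf.lintegral_lt_top.ne
  have h2 : ∫⁻ z, ENNReal.ofReal (-f z) ∂μ ≠ ⊤ := hf.neg.lintegral_lt_top.ne
  rw [integral_eq_lintegral_pos_part_sub_lintegral_neg_part hf, EReal.coe_sub,
    EReal.coe_ennreal_toReal h1, EReal.coe_ennreal_toReal h2]
  simp only [eExp, ← EReal.coe_neg, EReal.toENNReal_coe_real]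

/-- An extended-real function that is bounded below by an integrable one and has expectation less
than `+∞` agrees almost everywhere with an integrable real function. -/
theorem exists_integrable_of_eExp_ne_top {g : Z → EReal} (hg : Measurable g) {h : Z → ℝ}
    (hh : Integrable h μ) (hle : ∀ᵐ z ∂μ, (h z : EReal) ≤ g z) (htop : eExp μ g ≠ ⊤) :
    ∃ G : Z → ℝ, Integrable G μ ∧ ∀ᵐ z ∂μ, g z = (G z : EReal) := by
  have hneg : ∫⁻ z, (-g z).toENNReal ∂μ ≠ ⊤ := by
    refine ne_top_of_le_ne_top hh.neg.lintegral_lt_top.ne (lintegral_mono_ae ?_)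
    filter_upwards [hle] with z hz
    rw [Pi.neg_apply, ← EReal.toENNReal_coe_real]
    exact EReal.toENNReal_le_toENNReal (by simpa using hz)
  have hpos : ∫⁻ z, (g z).toENNReal ∂μ ≠ ⊤ := by
    intro hp
    apply htop
    rw [eExp, hp, ← EReal.coe_ennreal_toReal hneg]
    simp
  have hfin : ∀ᵐ z ∂μ, g z = ((g z).toReal : EReal) := by
    filter_upwards [hle, ae_lt_top hg.ereal_toENNReal hpos] with z hz hz'
    rw [EReal.coe_toReal]
    · exact EReal.toENNReal_ne_top_iff.1 hz'.ne
    · rintro h0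
      simp [h0] at hz
  refine ⟨fun z => (g z).toReal, ⟨hg.ereal_toReal.aestronglyMeasurable, ?_⟩, hfin⟩
  refine lt_of_le_of_lt (lintegral_mono_ae (g := fun z => (g z).toENNReal + (-g z).toENNReal) ?_) ?_
  · filter_upwards [hfin] with z hz
    rw [hz, ← EReal.coe_neg, EReal.toENNReal_coe_real, EReal.toENNReal_coe_real, EReal.toReal_coe,
      Real.enorm_eq_ofReal_abs]
    rcases abs_cases (g z).toReal with h | h <;> rw [h.1] <;> simp
  · rw [lintegral_add_left hg.ereal_toENNReal]
    exact ENNReal.add_lt_top.2 ⟨hpos.lt_top, hneg.lt_top⟩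

/-- Change of measure: the expectation under `Q ≪ P` is the expectation under `P` of the product
with the density. -/
theorem eExp_eq_eExp_rnDeriv {P Q : Measure Z} [IsProbabilityMeasure P] [IsProbabilityMeasure Q]
    (hQP : Q ≪ P) {f : Z → ℝ} (hf : Measurable f) :
    eExp Q (fun z => (f z : EReal)) =
      eExp P (fun z => (((Q.rnDeriv P z).toReal * f z : ℝ) : EReal)) := by
  have key : ∀ g : Z → ℝ, Measurable g → ∫⁻ z, ENNReal.ofReal (g z) ∂Q =
      ∫⁻ z, ENNReal.ofReal ((Q.rnDeriv P z).toReal * g z) ∂P := by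
    intro g hg
    rw [← lintegral_rnDeriv_mul hQP hg.ennreal_ofReal.aemeasurable]
    refine lintegral_congr_ae ?_
    filter_upwards [Measure.rnDeriv_lt_top Q P] with z hz
    rw [ENNReal.ofReal_mul ENNReal.toReal_nonneg, ENNReal.ofReal_toReal hz.ne]
  simp only [eExp, ← EReal.coe_neg, EReal.toENNReal_coe_real]
  rw [key f hf, key (fun z => -f z) hf.neg]
  simp only [mul_neg]

end Expectation

/-! ### Divergence generators and their conjugates -/

section Generator

variable {φ : ℝ → ℝ}

theorem genExt_of_pos {t : ℝ} (ht : 0 < t) : genExt φ t = (φ t : EReal) := if_pos ht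

theorem IsDivergenceGenerator.continuousOn (hφ : IsDivergenceGenerator φ) :
    ContinuousOn φ (Set.Ioi 0) :=
  hφ.convexOn.continuousOn isOpen_Ioi

theorem IsDivergenceGenerator.measurable_indicator (hφ : IsDivergenceGenerator φ) :
    Measurable ((Set.Ioi (0 : ℝ)).piecewise φ 0) :=
  hφ.continuousOn.measurable_piecewise continuousOn_const measurableSet_Ioi

theorem measurable_genExt (hφ : IsDivergenceGenerator φ) : Measurable (genExt φ) := by
  have : genExt φ = fun t => if 0 < t then ((Set.Ioi (0 : ℝ)).piecewise φ 0 t : EReal)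
      else if t = 0 then limsup (fun s : ℝ => (φ s : EReal)) (𝓝[>] (0 : ℝ)) else ⊤ := by
    funext t
    by_cases ht : 0 < t <;> simp [genExt, ht]
  rw [this]
  exact Measurable.ite measurableSet_Ioi hφ.measurable_indicator.coe_real_ereal
    (Measurable.ite (measurableSet_singleton 0) measurable_const measurable_const)

/-- A generator is bounded below by an affine function `t ↦ -C (t + 1)`, by
comparison with the secants on `[1/2, 1]` and `[1, 2]`. -/
theorem IsDivergenceGenerator.exists_lower_bound (hφ : IsDivergenceGenerator φ) :
    ∃ C : ℝ, ∀ t : ℝ, 0 ≤ t → ((-C * (t + 1) : ℝ) : EReal) ≤ genExt φ t := by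
  obtain ⟨C, hC⟩ : ∃ C : ℝ, ∀ t : ℝ, 0 < t → -C * (t + 1) ≤ φ t := by
    refine ⟨2 * |φ (1 / 2)| + |φ 2|, fun t ht => ?_⟩
    have a1 := neg_abs_le (φ (1 / 2))
    have a2 := neg_abs_le (φ 2)
    have a3 := le_abs_self (φ (1 / 2))
    have a4 := le_abs_self (φ 2)
    have b1 := abs_nonneg (φ (1 / 2))
    have b2 := abs_nonneg (φ 2)
    rcases lt_trichotomy t 1 with h | rfl | h
    · have h1 := hφ.convexOn.slope_mono_adjacent (Set.mem_Ioi.2 ht)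
        (Set.mem_Ioi.2 (by norm_num : (0 : ℝ) < 2)) h (by norm_num)
      rw [hφ.one, div_le_div_iff₀ (by linarith) (by norm_num)] at h1
      nlinarith
    · rw [hφ.one]
      nlinarith
    · have h1 := hφ.convexOn.slope_mono_adjacent
        (Set.mem_Ioi.2 (by norm_num : (0 : ℝ) < 1 / 2)) (Set.mem_Ioi.2 ht) (by norm_num) h
      rw [hφ.one, div_le_div_iff₀ (by norm_num) (by linarith)] at h1
      nlinarith
  -- `phiConj_le_iff` carries the bound over to the limit value at `0`
  have h : phiConj φ (-C) ≤ (C : EReal) := by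
    rw [phiConj_le_iff]
    intro t ht
    linarith [hC t ht]
  refine ⟨C, fun t ht => ?_⟩
  have h1 : ((-C * t : ℝ) : EReal) - genExt φ t ≤ (C : EReal) :=
    (le_iSup₂ (f := fun (t : ℝ) (_ : 0 ≤ t) => ((-C * t : ℝ) : EReal) - genExt φ t) t ht).trans h
  induction hg : genExt φ t with
  | bot =>
    rw [hg, EReal.coe_sub_bot] at h1
    simp at h1
  | top => simp
  | coe x =>
    rw [hg] at h1
    have h2 : -C * t - x ≤ C := by exact_mod_cast h1
    exact_mod_cast (by linarith : -C * (t + 1) ≤ x)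

theorem phiConj_mono (φ : ℝ → ℝ) : Monotone (phiConj φ) := by
  intro s s' h
  refine iSup₂_mono fun t ht => EReal.sub_le_sub ?_ le_rfl
  exact_mod_cast mul_le_mul_of_nonneg_right h ht

theorem measurable_conjPersp (φ : ℝ → ℝ) (η : ℝ) : Measurable (conjPersp φ η) := by
  by_cases hη : η = 0
  · subst hη
    unfold conjPersp
    simp only [if_true]
    exact Measurable.ite measurableSet_Iic measurable_const measurable_const
  · have : conjPersp φ η = fun s => (η : EReal) * phiConj φ (s / η) := by
      funext s
      simp [conjPersp, hη]
    rw [this]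
    exact measurable_const.mul ((phiConj_mono φ).measurable.comp (measurable_id.div_const η))

/-- The value `φ(1) = 0` bounds the perspective of the conjugate from below. -/
theorem le_conjPersp (hφ : IsDivergenceGenerator φ) {η : ℝ} (hη : 0 ≤ η) (s : ℝ) :
    (s : EReal) ≤ conjPersp φ η s := by
  induction hc : conjPersp φ η s with
  | top => simp
  | coe c =>
    have := (conjPersp_le_iff φ η s c hη).1 hc.le 1 one_pos
    rw [hφ.one] at this
    exact_mod_cast (by linarith : s ≤ c)
  | bot =>
    have := (conjPersp_le_iff φ η s (s - 1) hη).1 (by simp [hc]) 1 one_pos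
    rw [hφ.one] at this
    linarith

/-- The Fenchel inequality, including the boundary cases `η = 0` and `t = 0`. -/
theorem mul_le_conjPersp_add (φ : ℝ → ℝ) {η s t c g : ℝ} (hη : 0 ≤ η) (ht : 0 ≤ t)
    (hc : conjPersp φ η s = (c : EReal)) (hg : genExt φ t = (g : EReal)) :
    s * t ≤ c + η * g := by
  rcases hη.lt_or_eq with hη | rfl
  · have h1 : ((s / η * t : ℝ) : EReal) - genExt φ t ≤ phiConj φ (s / η) :=
      le_iSup₂ (f := fun (t : ℝ) (_ : 0 ≤ t) => ((s / η * t : ℝ) : EReal) - genExt φ t) t ht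
    have h2 : phiConj φ (s / η) ≤ ((c / η : ℝ) : EReal) := by
      rw [EReal.coe_div, EReal.le_div_iff_mul_le (by exact_mod_cast hη) (EReal.coe_ne_top _),
        mul_comm, ← hc, conjPersp, if_neg hη.ne']
    have h3 : s / η * t - g ≤ c / η := by
      have := h1.trans h2
      rw [hg] at this
      exact_mod_cast this
    rw [le_div_iff₀ hη] at h3
    have : (s / η * t - g) * η = s * t - η * g := by field_simp
    linarith
  · by_cases hs : s ≤ 0
    · have : (0 : ℝ) = c := by
        simp only [conjPersp, if_true, hs] at hc
        exact_mod_cast hc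
      nlinarith
    · simp [conjPersp, hs] at hc

end Generator

/-! ### Weak duality -/

section WeakDuality

variable {Z : Type*} [MeasurableSpace Z] {φ : ℝ → ℝ} {P : Measure Z} [IsProbabilityMeasure P]
  {f : Z → ℝ}

/-- The integrability of `f` makes the perspective term bounded below by an integrable function,
so that a finite dual value yields an integrable perspective term. -/
theorem exists_integrable_conjPersp (hφ : IsDivergenceGenerator φ) (hf : Measurable f)
    (hfi : Integrable f P) {η ν : ℝ} (hη : 0 ≤ η)
    (htop : eExp P (fun z => conjPersp φ η (ν - f z)) ≠ ⊤) :
    ∃ c : Z → ℝ, Integrable c P ∧ ∀ᵐ z ∂P, conjPersp φ η (ν - f z) = (c z : EReal) :=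
  exists_integrable_of_eExp_ne_top
    ((measurable_conjPersp φ η).comp (measurable_const.sub hf))
    ((integrable_const ν).sub hfi) (ae_of_all _ fun _ => le_conjPersp hφ hη _) htop

theorem dualObj_le_eExp (hφ : IsDivergenceGenerator φ) (hf : Measurable f) (hfi : Integrable f P)
    {ρ η ν : ℝ} (hη : 0 ≤ η) {Q : Measure Z} (hQ : Q ∈ phiBall φ P ρ) :
    dualObj φ P ρ f η ν ≤ eExp Q (fun z => (f z : EReal)) := by
  obtain ⟨hQ1, hQP, hD⟩ := hQ
  by_cases htop : eExp P (fun z => conjPersp φ η (ν - f z)) = ⊤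
  · simp [dualObj, htop]
  obtain ⟨c, hci, hc⟩ := exists_integrable_conjPersp hφ hf hfi hη htop
  obtain ⟨C, hC⟩ := hφ.exists_lower_bound
  have hqi : Integrable (fun z => (Q.rnDeriv P z).toReal) P := Measure.integrable_toReal_rnDeriv
  have hq1 : ∫ z, (Q.rnDeriv P z).toReal ∂P = 1 := by
    rw [Measure.integral_toReal_rnDeriv hQP]
    simp
  obtain ⟨g, hgi, hg⟩ := exists_integrable_of_eExp_ne_top (μ := P)
    (g := fun z => genExt φ ((Q.rnDeriv P z).toReal))
    ((measurable_genExt hφ).comp (Measure.measurable_rnDeriv Q P).ennreal_toReal)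
    ((hqi.add (integrable_const 1)).const_mul (-C))
    (ae_of_all _ fun z => hC _ ENNReal.toReal_nonneg)
    (ne_top_of_le_ne_top (EReal.coe_ne_top ρ) hD)
  have hgρ : ∫ z, g z ∂P ≤ ρ := by
    rw [phiDiv, eExp_congr_ae hg, eExp_coe_of_integrable hgi] at hD
    exact_mod_cast hD
  have hint : Integrable (fun z => ν * (Q.rnDeriv P z).toReal - c z - η * g z) P :=
    ((hqi.const_mul ν).sub hci).sub (hgi.const_mul η)
  rw [eExp_eq_eExp_rnDeriv hQP hf]
  calc dualObj φ P ρ f η ν = ((ν - ρ * η - ∫ z, c z ∂P : ℝ) : EReal) := by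
        rw [dualObj, eExp_congr_ae hc, eExp_coe_of_integrable hci, ← EReal.coe_sub]
    _ ≤ ((∫ z, (ν * (Q.rnDeriv P z).toReal - c z - η * g z) ∂P : ℝ) : EReal) := by
        have h1 : ∫ z, (ν * (Q.rnDeriv P z).toReal - c z - η * g z) ∂P =
            ν * 1 - ∫ z, c z ∂P - η * ∫ z, g z ∂P := by
          rw [integral_sub (by exact (hqi.const_mul ν).sub hci) (hgi.const_mul η),
            integral_sub (hqi.const_mul ν) hci, integral_const_mul, integral_const_mul, hq1]
        have h2 := mul_le_mul_of_nonneg_left hgρ hη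
        rw [h1]
        exact_mod_cast (by linarith :
          ν - ρ * η - ∫ z, c z ∂P ≤ ν * 1 - ∫ z, c z ∂P - η * ∫ z, g z ∂P)
    _ ≤ eExp P (fun z => (((Q.rnDeriv P z).toReal * f z : ℝ) : EReal)) := by
        rw [← eExp_coe_of_integrable hint]
        refine eExp_mono_ae ?_
        filter_upwards [hc, hg] with z hcz hgz
        have := mul_le_conjPersp_add φ hη ENNReal.toReal_nonneg hcz hgz
        exact_mod_cast (by linarith : ν * (Q.rnDeriv P z).toReal - c z - η * g z ≤
          (Q.rnDeriv P z).toReal * f z)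

theorem dualObj_le_worstCase (hφ : IsDivergenceGenerator φ) (hf : Measurable f)
    (hfi : Integrable f P) {ρ η ν : ℝ} (hη : 0 ≤ η) :
    dualObj φ P ρ f η ν ≤ worstCase φ P ρ f :=
  le_iInf₂ fun _ hQ => dualObj_le_eExp hφ hf hfi hη hQ

end WeakDuality

/-! ### Test densities -/

/-- A measurable function bounded away from `0` and from `∞`. Such functions, as densities with
respect to the reference law, form a class small enough that every integral in the duality argument
is finite, and large enough to detect the dual objective. -/
structure IsTestDensity {Z : Type*} [MeasurableSpace Z] (q : Z → ℝ) : Prop where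
  measurable : Measurable q
  exists_lower : ∃ a : ℝ, 0 < a ∧ ∀ z, a ≤ q z
  exists_upper : ∃ b : ℝ, ∀ z, q z ≤ b

namespace IsTestDensity

variable {Z : Type*} [MeasurableSpace Z] {φ : ℝ → ℝ} {P : Measure Z} {f q r : Z → ℝ}

theorem pos (hq : IsTestDensity q) (z : Z) : 0 < q z := by
  obtain ⟨a, ha, h⟩ := hq.exists_lower
  exact ha.trans_le (h z)

theorem const {t : ℝ} (ht : 0 < t) : IsTestDensity (fun _ : Z => t) :=
  ⟨measurable_const, ⟨t, ht, fun _ => le_rfl⟩, ⟨t, fun _ => le_rfl⟩⟩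

theorem const_mul (hq : IsTestDensity q) {s : ℝ} (hs : 0 < s) :
    IsTestDensity (fun z => s * q z) := by
  obtain ⟨a, ha, h⟩ := hq.exists_lower
  obtain ⟨b, h'⟩ := hq.exists_upper
  exact ⟨hq.measurable.const_mul s,
    ⟨s * a, mul_pos hs ha, fun z => mul_le_mul_of_nonneg_left (h z) hs.le⟩,
    ⟨s * b, fun z => mul_le_mul_of_nonneg_left (h' z) hs.le⟩⟩

theorem add (hq : IsTestDensity q) (hr : IsTestDensity r) :
    IsTestDensity (fun z => q z + r z) := by
  obtain ⟨a, ha, h⟩ := hq.exists_lower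
  obtain ⟨b, h'⟩ := hq.exists_upper
  obtain ⟨b', k'⟩ := hr.exists_upper
  exact ⟨hq.measurable.add hr.measurable, ⟨a, ha, fun z => by linarith [h z, hr.pos z]⟩,
    ⟨b + b', fun z => add_le_add (h' z) (k' z)⟩⟩

theorem ite (hq : IsTestDensity q) (hr : IsTestDensity r) {p : Z → Prop} [DecidablePred p]
    (hp : MeasurableSet {z | p z}) : IsTestDensity (fun z => if p z then q z else r z) := by
  obtain ⟨a, ha, h⟩ := hq.exists_lower
  obtain ⟨b, h'⟩ := hq.exists_upper
  obtain ⟨a', ha', k⟩ := hr.exists_lower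
  obtain ⟨b', k'⟩ := hr.exists_upper
  refine ⟨Measurable.ite hp hq.measurable hr.measurable, ⟨min a a', lt_min ha ha', fun z => ?_⟩,
    ⟨max b b', fun z => ?_⟩⟩
  · split_ifs
    exacts [(min_le_left _ _).trans (h z), (min_le_right _ _).trans (k z)]
  · split_ifs
    exacts [(h' z).trans (le_max_left _ _), (k' z).trans (le_max_right _ _)]

theorem convex_comb (hq : IsTestDensity q) (hr : IsTestDensity r) {a b : ℝ} (ha : 0 ≤ a)
    (hb : 0 ≤ b) (hab : a + b = 1) : IsTestDensity (fun z => a * q z + b * r z) := by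
  rcases ha.eq_or_lt with rfl | ha
  · obtain rfl : b = 1 := by linarith
    simpa using hr
  rcases hb.eq_or_lt with rfl | hb
  · obtain rfl : a = 1 := by linarith
    simpa using hq
  exact (hq.const_mul ha).add (hr.const_mul hb)

theorem measurable_comp (hq : IsTestDensity q) (hφ : IsDivergenceGenerator φ) :
    Measurable (fun z => φ (q z)) := by
  have : (fun z => φ (q z)) = fun z => (Set.Ioi (0 : ℝ)).piecewise φ 0 (q z) := by
    funext z
    rw [Set.piecewise_eq_of_mem _ _ _ (Set.mem_Ioi.2 (hq.pos z))]
  rw [this]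
  exact hφ.measurable_indicator.comp hq.measurable

theorem integrable_mul (hq : IsTestDensity q) (hfi : Integrable f P) :
    Integrable (fun z => f z * q z) P := by
  obtain ⟨b, h'⟩ := hq.exists_upper
  refine hfi.mul_bdd (c := b) hq.measurable.aestronglyMeasurable (ae_of_all _ fun z => ?_)
  rw [Real.norm_of_nonneg (hq.pos z).le]
  exact h' z

variable [IsProbabilityMeasure P]

theorem integrable (hq : IsTestDensity q) : Integrable q P := by
  simpa using hq.integrable_mul (integrable_const (1 : ℝ))

theorem integrable_comp (hq : IsTestDensity q) (hφ : IsDivergenceGenerator φ) :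
    Integrable (fun z => φ (q z)) P := by
  obtain ⟨a, ha, h⟩ := hq.exists_lower
  obtain ⟨b, h'⟩ := hq.exists_upper
  have hsub : Set.Icc a b ⊆ Set.Ioi 0 := fun t ht => ha.trans_le ht.1
  obtain ⟨B, hB⟩ := isCompact_Icc.exists_bound_of_continuousOn (hφ.continuousOn.mono hsub)
  exact Integrable.of_bound (hq.measurable_comp hφ).aestronglyMeasurable B
    (ae_of_all _ fun z => hB _ ⟨h z, h' z⟩)

theorem integral_pos (hq : IsTestDensity q) : 0 < ∫ z, q z ∂P := by
  obtain ⟨a, ha, h⟩ := hq.exists_lower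
  calc 0 < a := ha
    _ = ∫ _, a ∂P := by simp
    _ ≤ ∫ z, q z ∂P := integral_mono (integrable_const a) hq.integrable h

/-- A test density of integral `1` with divergence at most `ρ` bounds the worst case. -/
theorem worstCase_le (hq : IsTestDensity q) (hφ : IsDivergenceGenerator φ) (hf : Measurable f)
    (hfi : Integrable f P) {ρ : ℝ} (h1 : ∫ z, q z ∂P = 1) (hρ : ∫ z, φ (q z) ∂P ≤ ρ) :
    worstCase φ P ρ f ≤ ((∫ z, f z * q z ∂P : ℝ) : EReal) := by
  set Q : Measure Z := P.withDensity fun z => ENNReal.ofReal (q z) with hQ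
  have hQP : Q ≪ P := withDensity_absolutelyContinuous _ _
  have hQ1 : IsProbabilityMeasure Q := by
    refine ⟨?_⟩
    rw [hQ, withDensity_apply _ MeasurableSet.univ, Measure.restrict_univ,
      ← ofReal_integral_eq_lintegral_ofReal hq.integrable (ae_of_all _ fun z => (hq.pos z).le), h1,
      ENNReal.ofReal_one]
  have hrn : ∀ᵐ z ∂P, (Q.rnDeriv P z).toReal = q z := by
    filter_upwards [Measure.rnDeriv_withDensity P hq.measurable.ennreal_ofReal] with z hz
    rw [hz, ENNReal.toReal_ofReal (hq.pos z).le]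
  have hD : phiDiv φ Q P = ((∫ z, φ (q z) ∂P : ℝ) : EReal) := by
    rw [← eExp_coe_of_integrable (hq.integrable_comp hφ)]
    refine eExp_congr_ae ?_
    filter_upwards [hrn] with z hz
    rw [hz, genExt_of_pos (hq.pos z)]
  have hE : eExp Q (fun z => (f z : EReal)) = ((∫ z, f z * q z ∂P : ℝ) : EReal) := by
    rw [← eExp_coe_of_integrable (hq.integrable_mul hfi), eExp_eq_eExp_rnDeriv hQP hf]
    refine eExp_congr_ae ?_
    filter_upwards [hrn] with z hz
    rw [hz, mul_comm]
  rw [← hE]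
  exact iInf₂_le Q ⟨hQ1, hQP, by rw [hD]; exact_mod_cast hρ⟩

end IsTestDensity

/-! ### Multipliers by separation -/

section Separation

variable {Z : Type*} [MeasurableSpace Z] {φ : ℝ → ℝ} {P : Measure Z} [IsProbabilityMeasure P]
  {f : Z → ℝ}

/-- The triples that strictly dominate `(E q, E φ(q), E f q)` in the last two entries, and agree
with it in the first, for some test density `q`. -/
def testImage (φ : ℝ → ℝ) (P : Measure Z) (f : Z → ℝ) : Set (ℝ × ℝ × ℝ) :=
  {p | ∃ q, IsTestDensity q ∧ ∫ z, q z ∂P = p.1 ∧ ∫ z, φ (q z) ∂P < p.2.1 ∧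
    ∫ z, f z * q z ∂P < p.2.2}

theorem integral_comp_convex_comb_le (hφ : IsDivergenceGenerator φ) {q r : Z → ℝ}
    (hq : IsTestDensity q) (hr : IsTestDensity r) {a b : ℝ} (ha : 0 ≤ a) (hb : 0 ≤ b)
    (hab : a + b = 1) :
    ∫ z, φ (a * q z + b * r z) ∂P ≤ a * ∫ z, φ (q z) ∂P + b * ∫ z, φ (r z) ∂P := by
  have hq' := (hq.integrable_comp (P := P) hφ).const_mul a
  have hr' := (hr.integrable_comp (P := P) hφ).const_mul b
  rw [← integral_const_mul, ← integral_const_mul, ← integral_add hq' hr']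
  exact integral_mono ((hq.convex_comb hr ha hb hab).integrable_comp hφ) (hq'.add hr')
    fun z => hφ.convexOn.2 (hq.pos z) (hr.pos z) ha hb hab

/-- A strict inequality between convex combinations of real numbers. -/
theorem convex_comb_lt {a b x x' y y' : ℝ} (ha : 0 ≤ a) (hb : 0 ≤ b) (hab : a + b = 1)
    (hx : x < x') (hy : y < y') : a * x + b * y < a * x' + b * y' := by
  rcases ha.eq_or_lt with rfl | ha
  · obtain rfl : b = 1 := by linarith
    simpa using hy
  · nlinarith

theorem convex_testImage (hφ : IsDivergenceGenerator φ) (hfi : Integrable f P) :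
    Convex ℝ (testImage φ P f) := by
  rintro ⟨x, y, w⟩ ⟨q, hq, h1, h2, h3⟩ ⟨x', y', w'⟩ ⟨r, hr, k1, k2, k3⟩ a b ha hb hab
  refine ⟨_, hq.convex_comb hr ha hb hab, ?_, ?_, ?_⟩
  · simp only at h1 k1
    simp only [Prod.fst_add, Prod.smul_fst, smul_eq_mul]
    rw [← h1, ← k1, integral_add (hq.integrable.const_mul a) (hr.integrable.const_mul b),
      integral_const_mul, integral_const_mul]
  · exact (integral_comp_convex_comb_le hφ hq hr ha hb hab).trans_lt
      (convex_comb_lt ha hb hab h2 k2)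
  · have : ∀ z, f z * (a * q z + b * r z) = a * (f z * q z) + b * (f z * r z) := fun z => by ring
    simp only [this]
    rw [integral_add ((hq.integrable_mul hfi).const_mul a) ((hr.integrable_mul hfi).const_mul b),
      integral_const_mul, integral_const_mul]
    exact convex_comb_lt ha hb hab h3 k3

/-- Along each ray `s ↦ s q` of test densities the divergence is a finite convex function of `s`,
hence continuous, so that the image contains a neighbourhood of each of its points. -/
theorem isOpen_testImage (hφ : IsDivergenceGenerator φ) : IsOpen (testImage φ P f) := by
  rw [isOpen_iff_mem_nhds]
  rintro ⟨x, y, w⟩ ⟨q, hq, h1, h2, h3⟩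
  simp only at h1 h2 h3
  have hx : 0 < x := h1 ▸ hq.integral_pos
  have hcvx : ConvexOn ℝ (Set.Ioi 0) (fun s : ℝ => ∫ z, φ (s * q z) ∂P) := by
    refine ⟨convex_Ioi 0, fun s hs s' hs' a b ha hb hab => ?_⟩
    have := integral_comp_convex_comb_le (P := P) hφ (hq.const_mul hs) (hq.const_mul hs') ha hb hab
    simp only [smul_eq_mul, add_mul]
    simpa only [mul_assoc] using this
  have hcont : ContinuousAt (fun s : ℝ => ∫ z, φ (s * q z) ∂P) 1 :=
    (hcvx.continuousOn isOpen_Ioi).continuousAt (Ioi_mem_nhds one_pos)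
  have hdiv : ContinuousAt (fun p : ℝ × ℝ × ℝ => p.1 / x) (x, y, w) :=
    continuousAt_fst.div_const x
  have hcont' : ContinuousAt (fun p : ℝ × ℝ × ℝ => ∫ z, φ (p.1 / x * q z) ∂P) (x, y, w) :=
    ContinuousAt.comp (g := fun s : ℝ => ∫ z, φ (s * q z) ∂P) (by simpa [div_self hx.ne']) hdiv
  have e1 : ∀ᶠ p : ℝ × ℝ × ℝ in 𝓝 (x, y, w), 0 < p.1 :=
    continuousAt_fst.eventually_const_lt hx
  have e2 : ∀ᶠ p : ℝ × ℝ × ℝ in 𝓝 (x, y, w), ∫ z, φ (p.1 / x * q z) ∂P < p.2.1 :=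
    hcont'.eventually_lt (by fun_prop) (by simpa [div_self hx.ne'] using h2)
  have e3 : ∀ᶠ p : ℝ × ℝ × ℝ in 𝓝 (x, y, w), p.1 / x * ∫ z, f z * q z ∂P < p.2.2 :=
    (hdiv.mul continuousAt_const).eventually_lt (by fun_prop) (by simpa [div_self hx.ne'] using h3)
  filter_upwards [e1, e2, e3] with p p1 p2 p3
  refine ⟨_, hq.const_mul (div_pos p1 hx), ?_, p2, ?_⟩
  · rw [integral_const_mul, h1, div_mul_cancel₀ _ hx.ne']
  · have : ∀ z, f z * (p.1 / x * q z) = p.1 / x * (f z * q z) := fun z => by ring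
    simp only [this]
    rwa [integral_const_mul]

/-- Existence of multipliers: separate the point `(1, ρ, v)` from the open convex set
`testImage φ P f`. Since `ρ > 0`, the constant density `1` is a Slater point, which excludes a
separating functional that vanishes on the last coordinate. -/
theorem exists_multipliers (hφ : IsDivergenceGenerator φ) (hf : Measurable f)
    (hfi : Integrable f P) {ρ v : ℝ} (hρ : 0 < ρ) (hv : (v : EReal) ≤ worstCase φ P ρ f) :
    ∃ η ν : ℝ, 0 ≤ η ∧ ∀ q, IsTestDensity q →
      ∫ z, ((ν - f z) * q z - η * φ (q z)) ∂P ≤ ν - ρ * η - v := by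
  have hmem : ((1, ρ, v) : ℝ × ℝ × ℝ) ∉ testImage φ P f := by
    rintro ⟨q, hq, h1, h2, h3⟩
    have := hv.trans (hq.worstCase_le hφ hf hfi h1 h2.le)
    exact absurd (by exact_mod_cast this) (not_le.2 h3)
  obtain ⟨F, hF⟩ := geometric_hahn_banach_point_open (convex_testImage hφ hfi)
    (isOpen_testImage hφ) hmem
  obtain ⟨α, β, κ, hlin⟩ : ∃ α β κ : ℝ, ∀ a b c : ℝ, F (a, b, c) = α * a + β * b + κ * c := by
    refine ⟨F (1, 0, 0), F (0, 1, 0), F (0, 0, 1), fun a b c => ?_⟩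
    have : ((a, b, c) : ℝ × ℝ × ℝ) = a • (1, 0, 0) + b • (0, 1, 0) + c • (0, 0, 1) := by simp
    rw [this, map_add, map_add, map_smul, map_smul, map_smul]
    simp only [smul_eq_mul]
    ring
  have hsep : ∀ q, IsTestDensity q → ∀ b c : ℝ, ∫ z, φ (q z) ∂P < b → ∫ z, f z * q z ∂P < c →
      α + β * ρ + κ * v < α * ∫ z, q z ∂P + β * b + κ * c := by
    intro q hq b c hb hc
    have := hF (_, b, c) ⟨q, hq, rfl, hb, hc⟩
    rw [hlin, hlin] at this
    simpa using this
  have hone : ∀ b c : ℝ, 0 < b → ∫ z, f z ∂P < c → β * ρ + κ * v < β * b + κ * c := by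
    intro b c hb hc
    have := hsep _ (IsTestDensity.const one_pos) b c (by simpa [hφ.one] using hb)
      (by simpa using hc)
    simp only [integral_const, probReal_univ, one_smul] at this
    linarith
  set m := ∫ z, f z ∂P
  -- the image is closed upwards in its last two coordinates, so the functional is monotone in them
  have hβ : 0 ≤ β := by
    by_contra! h
    obtain ⟨N, hN⟩ := exists_gt ((β * ρ + κ * v - κ * (m + 1)) / β)
    have h1 := hone (max N 1) (m + 1) (by positivity) (by linarith)
    rw [div_lt_iff_of_neg h] at hN
    have := mul_le_mul_of_nonpos_left (le_max_left N 1) h.le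
    linarith
  have hκ : 0 ≤ κ := by
    by_contra! h
    obtain ⟨N, hN⟩ := exists_gt ((β * ρ + κ * v - β * 1) / κ)
    have h1 := hone 1 (max N (m + 1)) one_pos (lt_max_of_lt_right (by linarith))
    rw [div_lt_iff_of_neg h] at hN
    have := mul_le_mul_of_nonpos_left (le_max_left N (m + 1)) h.le
    linarith
  have hκ' : 0 < κ := by
    refine hκ.lt_of_ne ?_
    rintro rfl
    have := hone (ρ / 2) (m + 1) (by positivity) (by linarith)
    nlinarith
  refine ⟨β / κ, -α / κ, by positivity, fun q hq => ?_⟩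
  have hlim : α + β * ρ + κ * v ≤
      α * ∫ z, q z ∂P + β * ∫ z, φ (q z) ∂P + κ * ∫ z, f z * q z ∂P := by
    refine le_of_forall_pos_lt_add fun ε hε => ?_
    have hs : 0 < β + κ := by linarith
    have := hsep q hq (∫ z, φ (q z) ∂P + ε / (β + κ)) (∫ z, f z * q z ∂P + ε / (β + κ))
      (by linarith [div_pos hε hs]) (by linarith [div_pos hε hs])
    have he : (β + κ) * (ε / (β + κ)) = ε := mul_div_cancel₀ _ hs.ne'
    linarith
  have hint : ∫ z, ((-α / κ - f z) * q z - β / κ * φ (q z)) ∂P =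
      -α / κ * ∫ z, q z ∂P - ∫ z, f z * q z ∂P - β / κ * ∫ z, φ (q z) ∂P := by
    have : ∀ z, (-α / κ - f z) * q z - β / κ * φ (q z) =
        -α / κ * q z - f z * q z - β / κ * φ (q z) := fun z => by ring
    simp only [this]
    have i1 := (hq.integrable (P := P)).const_mul (-α / κ)
    have i2 := hq.integrable_mul hfi
    rw [integral_sub (by exact i1.sub i2) ((hq.integrable_comp hφ).const_mul _),
      integral_sub i1 i2, integral_const_mul, integral_const_mul]
  rw [hint]
  refine le_of_mul_le_mul_left ?_ hκ'
  have l : κ * (-α / κ * ∫ z, q z ∂P - ∫ z, f z * q z ∂P - β / κ * ∫ z, φ (q z) ∂P) =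
      -α * ∫ z, q z ∂P - κ * ∫ z, f z * q z ∂P - β * ∫ z, φ (q z) ∂P := by
    field_simp
  have l' : κ * (-α / κ - ρ * (β / κ) - v) = -α - ρ * β - κ * v := by field_simp
  rw [l, l']
  linarith

end Separation

/-! ### Interchange of supremum and expectation -/

section Interchange

variable {Z : Type*}

open Classical in
/-- The running maximizer of `t ↦ (ν - f z) t - η φ(t)` among the first terms of a sequence `t`. -/
noncomputable def runningMax (φ : ℝ → ℝ) (f : Z → ℝ) (η ν : ℝ) (t : ℕ → ℝ) : ℕ → Z → ℝ
  | 0 => fun _ => t 0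
  | k + 1 => fun z =>
      if (ν - f z) * runningMax φ f η ν t k z - η * φ (runningMax φ f η ν t k z) <
          (ν - f z) * t (k + 1) - η * φ (t (k + 1))
      then t (k + 1) else runningMax φ f η ν t k z

theorem monotone_runningMax (φ : ℝ → ℝ) (f : Z → ℝ) (η ν : ℝ) (t : ℕ → ℝ) (z : Z) :
    Monotone fun k => (ν - f z) * runningMax φ f η ν t k z - η * φ (runningMax φ f η ν t k z) := by
  refine monotone_nat_of_le_succ fun k => ?_
  simp only [runningMax]
  split_ifs with h
  · exact h.le
  · exact le_rfl

theorem le_runningMax (φ : ℝ → ℝ) (f : Z → ℝ) (η ν : ℝ) (t : ℕ → ℝ) (z : Z) (k : ℕ) :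
    (ν - f z) * t k - η * φ (t k) ≤
      (ν - f z) * runningMax φ f η ν t k z - η * φ (runningMax φ f η ν t k z) := by
  cases k with
  | zero => exact le_rfl
  | succ k =>
    simp only [runningMax]
    split_ifs with h
    · exact le_rfl
    · exact not_lt.1 h

variable [MeasurableSpace Z] {φ : ℝ → ℝ} {P : Measure Z} [IsProbabilityMeasure P] {f : Z → ℝ}

theorem isTestDensity_runningMax (hφ : IsDivergenceGenerator φ) (hf : Measurable f) (η ν : ℝ)
    {t : ℕ → ℝ} (ht : ∀ k, 0 < t k) (k : ℕ) : IsTestDensity (runningMax φ f η ν t k) := by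
  induction k with
  | zero => exact IsTestDensity.const (ht 0)
  | succ k ih =>
    refine IsTestDensity.ite (IsTestDensity.const (ht (k + 1))) ih ?_
    refine measurableSet_lt ?_ ?_
    · exact ((measurable_const.sub hf).mul ih.measurable).sub ((ih.measurable_comp hφ).const_mul η)
    · exact ((measurable_const.sub hf).mul_const _).sub measurable_const

/-- A bound for the Lagrangian over the test densities bounds the expected perspective: a running
maximizer over a dense sequence of `(0, ∞)` approximates the pointwise supremum from below, and
monotone convergence applies. -/
theorem eExp_conjPersp_le (hφ : IsDivergenceGenerator φ) (hf : Measurable f)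
    (hfi : Integrable f P) {η ν R : ℝ} (hη : 0 ≤ η)
    (hR : ∀ q, IsTestDensity q → ∫ z, ((ν - f z) * q z - η * φ (q z)) ∂P ≤ R) :
    eExp P (fun z => conjPersp φ η (ν - f z)) ≤ (R : EReal) := by
  have : Nonempty (Set.Ioi (0 : ℝ)) := ⟨⟨1, Set.mem_Ioi.2 one_pos⟩⟩
  set t : ℕ → ℝ := fun k => TopologicalSpace.denseSeq (Set.Ioi (0 : ℝ)) k
  have ht : ∀ k, 0 < t k := fun k => (TopologicalSpace.denseSeq (Set.Ioi (0 : ℝ)) k).2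
  set q := runningMax φ f η ν t
  have hq : ∀ k, IsTestDensity (q k) := isTestDensity_runningMax hφ hf η ν ht
  set G : ℕ → Z → ℝ := fun k z => (ν - f z) * q k z - η * φ (q k z)
  have hGm : ∀ k, Measurable (G k) := fun k =>
    ((measurable_const.sub hf).mul (hq k).measurable).sub (((hq k).measurable_comp hφ).const_mul η)
  have hGi : ∀ k, Integrable (G k) P := fun k =>
    ((hq k).integrable_mul ((integrable_const ν).sub hfi)).sub
      (((hq k).integrable_comp hφ).const_mul η)
  have hGmono : ∀ z, Monotone fun k => G k z := monotone_runningMax φ f η ν t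
  -- on `(0, ∞)` a bound along the dense sequence is a bound everywhere, by continuity
  have hsup : ∀ z (B : ℝ), (∀ k, G k z ≤ B) → conjPersp φ η (ν - f z) ≤ (B : EReal) := by
    intro z B hB
    rw [conjPersp_le_iff _ _ _ _ hη]
    have hclosed : IsClosed {s : Set.Ioi (0 : ℝ) | (ν - f z) * s - η * φ s ≤ B} := by
      refine isClosed_le ?_ continuous_const
      have := hφ.continuousOn.domRestrict
      exact (continuous_const.mul continuous_subtype_val).sub (continuous_const.mul this)
    have hall : ∀ s : Set.Ioi (0 : ℝ), (ν - f z) * s - η * φ s ≤ B := by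
      intro s
      refine (TopologicalSpace.denseRange_denseSeq (Set.Ioi (0 : ℝ))).induction_on
        (p := fun s : Set.Ioi (0 : ℝ) => (ν - f z) * s - η * φ s ≤ B) s hclosed fun k => ?_
      exact (le_runningMax φ f η ν t z k).trans (hB k)
    exact fun s hs => hall ⟨s, hs⟩
  set S : Z → ℝ≥0∞ := fun z => ⨆ k, ENNReal.ofReal (G k z - G 0 z)
  have hSm : Measurable S := Measurable.iSup fun k => ((hGm k).sub (hGm 0)).ennreal_ofReal
  have hS : ∫⁻ z, S z ∂P ≤ ENNReal.ofReal (R - ∫ z, G 0 z ∂P) := by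
    rw [lintegral_iSup (f := fun k z => ENNReal.ofReal (G k z - G 0 z))
      (fun k => ((hGm k).sub (hGm 0)).ennreal_ofReal)
      (fun i j hij z => ENNReal.ofReal_le_ofReal (sub_le_sub_right (hGmono z hij) _))]
    refine iSup_le fun k => ?_
    rw [← ofReal_integral_eq_lintegral_ofReal (by exact (hGi k).sub (hGi 0))
      (ae_of_all _ fun z => sub_nonneg.2 (hGmono z (Nat.zero_le k))), integral_sub (hGi k) (hGi 0)]
    exact ENNReal.ofReal_le_ofReal (sub_le_sub_right (hR _ (hq k)) _)
  have hSfin : ∫⁻ z, S z ∂P ≠ ⊤ := ne_top_of_le_ne_top ENNReal.ofReal_ne_top hS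
  have hSi : Integrable (fun z => (S z).toReal) P := integrable_toReal_of_lintegral_ne_top
    hSm.aemeasurable hSfin
  have hae := ae_lt_top hSm hSfin
  calc eExp P (fun z => conjPersp φ η (ν - f z))
      ≤ eExp P (fun z => ((G 0 z + (S z).toReal : ℝ) : EReal)) := by
        refine eExp_mono_ae ?_
        filter_upwards [hae] with z hz
        refine hsup z _ fun k => ?_
        have h1 : G k z - G 0 z ≤ (S z).toReal :=
          (ENNReal.ofReal_le_iff_le_toReal hz.ne).1
            (le_iSup (fun k => ENNReal.ofReal (G k z - G 0 z)) k)
        linarith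
    _ = ((∫ z, G 0 z ∂P + ∫ z, (S z).toReal ∂P : ℝ) : EReal) := by
        rw [eExp_coe_of_integrable (by exact (hGi 0).add hSi), integral_add (hGi 0) hSi]
    _ ≤ (R : EReal) := by
        have h1 : ∫ z, (S z).toReal ∂P ≤ R - ∫ z, G 0 z ∂P := by
          rw [integral_toReal hSm.aemeasurable hae]
          exact ENNReal.toReal_le_of_le_ofReal (sub_nonneg.2 (hR _ (hq 0))) hS
        exact_mod_cast (by linarith : ∫ z, G 0 z ∂P + ∫ z, (S z).toReal ∂P ≤ R)

end Interchange

/-! ### Strong duality -/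

section StrongDuality

variable {Z : Type*} [MeasurableSpace Z] {φ : ℝ → ℝ} {P : Measure Z} [IsProbabilityMeasure P]
  {f : Z → ℝ}

/-- Strong duality with dual attainment, for an integrable loss. If the worst case is `-∞`, weak
duality makes every dual point optimal. -/
theorem isGreatest_dualObj (hφ : IsDivergenceGenerator φ) (hf : Measurable f)
    (hfi : Integrable f P) {ρ : ℝ} (hρ : 0 < ρ) :
    IsGreatest ((fun p : ℝ × ℝ => dualObj φ P ρ f p.1 p.2) '' {p | 0 ≤ p.1})
      (worstCase φ P ρ f) := by
  refine ⟨?_, ?_⟩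
  · induction hv : worstCase φ P ρ f with
    | bot =>
      refine ⟨(0, 0), le_refl (0 : ℝ), ?_⟩
      have := dualObj_le_worstCase (ρ := ρ) (ν := 0) hφ hf hfi le_rfl
      rwa [hv, le_bot_iff] at this
    | top =>
      have := (IsTestDensity.const (Z := Z) one_pos).worstCase_le hφ hf hfi (by simp)
        (by simpa [hφ.one] using hρ.le)
      rw [hv] at this
      simp at this
    | coe v =>
      obtain ⟨η, ν, hη, h⟩ := exists_multipliers hφ hf hfi hρ hv.ge
      refine ⟨(η, ν), hη, le_antisymm ?_ ?_⟩
      · exact (dualObj_le_worstCase hφ hf hfi hη).trans hv.le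
      · have := EReal.sub_le_sub (le_refl ((ν - ρ * η : ℝ) : EReal))
          (eExp_conjPersp_le hφ hf hfi hη h)
        refine le_trans ?_ this
        exact_mod_cast (by linarith : v ≤ ν - ρ * η - (ν - ρ * η - v))
  · rintro _ ⟨⟨η, ν⟩, hη, rfl⟩
    exact dualObj_le_worstCase hφ hf hfi hη

end StrongDuality

/-! ### Empirical laws -/

section Empirical

variable {Z : Type*} [MeasurableSpace Z] {M : ℕ}

theorem EReal.sum_ne_bot {ι : Type*} {s : Finset ι} {g : ι → EReal} (h : ∀ i ∈ s, g i ≠ ⊥) :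
    ∑ i ∈ s, g i ≠ ⊥ := by
  classical
  induction s using Finset.induction_on with
  | empty => simp
  | insert a s ha ih =>
    rw [Finset.sum_insert ha, Ne, EReal.add_eq_bot_iff, not_or]
    exact ⟨h a (Finset.mem_insert_self a s), ih fun i hi => h i (Finset.mem_insert_of_mem hi)⟩

theorem EReal.sum_eq_top {ι : Type*} {s : Finset ι} {g : ι → EReal} (h : ∀ i ∈ s, g i ≠ ⊥)
    {j : ι} (hj : j ∈ s) (hjt : g j = ⊤) : ∑ i ∈ s, g i = ⊤ := by
  classical
  rw [← Finset.add_sum_erase s g hj, hjt]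
  exact EReal.top_add_of_ne_bot (EReal.sum_ne_bot fun i hi => h i (Finset.mem_of_mem_erase hi))

theorem EReal.coe_sum {ι : Type*} (s : Finset ι) (g : ι → ℝ) :
    ((∑ i ∈ s, g i : ℝ) : EReal) = ∑ i ∈ s, (g i : EReal) := by
  classical
  induction s using Finset.induction_on with
  | empty => simp
  | insert a s ha ih => rw [Finset.sum_insert ha, Finset.sum_insert ha, EReal.coe_add, ih]

theorem isProbabilityMeasure_empLaw (hM : 0 < M) (z : Fin M → Z) :
    IsProbabilityMeasure (empLaw z) := by
  refine ⟨?_⟩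
  have h0 : (M : ℝ≥0∞) ≠ 0 := by exact_mod_cast hM.ne'
  simp [empLaw, Measure.smul_apply, Measure.finsetSum_apply,
    ENNReal.inv_mul_cancel h0 (ENNReal.natCast_ne_top M)]

variable [MeasurableSingletonClass Z]

theorem lintegral_empLaw (z : Fin M → Z) (g : Z → ℝ≥0∞) :
    ∫⁻ y, g y ∂(empLaw z) = (M : ℝ≥0∞)⁻¹ * ∑ m, g (z m) := by
  rw [empLaw, lintegral_smul_measure, lintegral_finsetSum_measure, smul_eq_mul]
  simp only [lintegral_dirac]

theorem integrable_empLaw (hM : 0 < M) (z : Fin M → Z) (g : Z → ℝ) : Integrable g (empLaw z) := by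
  have h0 : (M : ℝ≥0∞) ≠ 0 := by exact_mod_cast hM.ne'
  refine Integrable.smul_measure ?_ (ENNReal.inv_ne_top.2 h0)
  rw [integrable_finsetSum_measure]
  exact fun m _ => integrable_dirac (by simp)

theorem integral_empLaw (z : Fin M → Z) (g : Z → ℝ) :
    ∫ y, g y ∂(empLaw z) = (M : ℝ)⁻¹ * ∑ m, g (z m) := by
  rw [empLaw, integral_smul_measure,
    integral_finsetSum_measure fun m _ => integrable_dirac (by simp)]
  simp [integral_dirac]

/-- The expectation under an empirical law of a function without the value `-∞`, for which the sum
of extended reals has no indeterminate form. -/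
theorem eExp_empLaw (hM : 0 < M) (z : Fin M → Z) {g : Z → EReal} (hg : ∀ m, g (z m) ≠ ⊥) :
    eExp (empLaw z) g = (((M : ℝ)⁻¹ : ℝ) : EReal) * ∑ m, g (z m) := by
  have h0 : (M : ℝ≥0∞) ≠ 0 := by exact_mod_cast hM.ne'
  by_cases hfin : ∀ m, g (z m) ≠ ⊤
  · have hreal : ∀ m, g (z m) = ((g (z m)).toReal : EReal) :=
      fun m => (EReal.coe_toReal (hfin m) (hg m)).symm
    have h1 : eExp (empLaw z) g = eExp (empLaw z) (fun y => ((g y).toReal : EReal)) := by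
      simp only [eExp, lintegral_empLaw, ← hreal]
    rw [h1, eExp_coe_of_integrable (integrable_empLaw hM z _), integral_empLaw, EReal.coe_mul,
      EReal.coe_sum]
    simp only [← hreal]
  · push Not at hfin
    obtain ⟨j, hj⟩ := hfin
    have hpos : (M : ℝ≥0∞)⁻¹ * ∑ m, (g (z m)).toENNReal = ⊤ := by
      have : ∑ m, (g (z m)).toENNReal = ⊤ :=
        ENNReal.sum_eq_top.2 ⟨j, Finset.mem_univ j, by simp [hj]⟩
      rw [this, ENNReal.mul_top (ENNReal.inv_ne_zero.2 (ENNReal.natCast_ne_top M))]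
    have hneg : (M : ℝ≥0∞)⁻¹ * ∑ m, (-g (z m)).toENNReal ≠ ⊤ := by
      refine ENNReal.mul_ne_top (ENNReal.inv_ne_top.2 h0) (ENNReal.sum_ne_top.2 fun m _ => ?_)
      rw [EReal.toENNReal_ne_top_iff]
      simpa using hg m
    rw [eExp, lintegral_empLaw, lintegral_empLaw, hpos, ← EReal.coe_ennreal_toReal hneg,
      EReal.sum_eq_top (fun m _ => hg m) (Finset.mem_univ j) hj, EReal.coe_ennreal_top,
      EReal.top_sub_coe, EReal.coe_mul_top_of_pos (by positivity)]

end Empirical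

/-! ### Conic programs -/

section Conic

variable {Z : Type*} [MeasurableSpace Z] [MeasurableSingletonClass Z] {φ : ℝ → ℝ} {M : ℕ}

theorem mem_feasible_dualConic {ρ η ν : ℝ} {c u : Fin M → ℝ} :
    (η, ν, u) ∈ (dualConic φ ρ c).feasible ↔
      ∀ m, 0 ≤ η ∧ conjPersp φ η (ν - c m) ≤ (u m : EReal) := by
  have : ∀ m, ((dualConic φ ρ c).A (η, ν, u) + (dualConic φ ρ c).b) m = (ν - c m, η, u m) := by
    intro m
    simp [dualConic, sub_eq_add_neg]
  change (∀ m, ((dualConic φ ρ c).A (η, ν, u) + (dualConic φ ρ c).b) m ∈ conjCone φ) ↔ _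
  simp only [this]
  rfl

theorem conjPersp_ne_bot (hφ : IsDivergenceGenerator φ) {η : ℝ} (hη : 0 ≤ η) (s : ℝ) :
    conjPersp φ η s ≠ ⊥ := by
  intro h
  have := le_conjPersp hφ hη s
  simp [h] at this

theorem dualObj_empLaw (hφ : IsDivergenceGenerator φ) (hM : 0 < M) (z : Fin M → Z) (f : Z → ℝ)
    (ρ : ℝ) {η : ℝ} (ν : ℝ) (hη : 0 ≤ η) :
    dualObj φ (empLaw z) ρ f η ν = ((ν - ρ * η : ℝ) : EReal) -
      (((M : ℝ)⁻¹ : ℝ) : EReal) * ∑ m, conjPersp φ η (ν - f (z m)) := by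
  rw [dualObj, eExp_empLaw hM z fun m => conjPersp_ne_bot hφ hη _]

theorem obj_le_dualObj_empLaw (hφ : IsDivergenceGenerator φ) (hM : 0 < M) (z : Fin M → Z)
    (f : Z → ℝ) {ρ η ν : ℝ} {u : Fin M → ℝ}
    (h : (η, ν, u) ∈ (dualConic φ ρ fun m => f (z m)).feasible) :
    (((dualConic φ ρ fun m => f (z m)).obj (η, ν, u) : ℝ) : EReal) ≤
      dualObj φ (empLaw z) ρ f η ν := by
  rw [mem_feasible_dualConic] at h
  have hη : 0 ≤ η := (h ⟨0, hM⟩).1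
  rw [dualObj_empLaw hφ hM z f ρ ν hη]
  have h1 : ((((M : ℝ)⁻¹ : ℝ) : EReal) * ∑ m, conjPersp φ η (ν - f (z m))) ≤
      (((M : ℝ)⁻¹ * ∑ m, u m : ℝ) : EReal) := by
    rw [EReal.coe_mul, EReal.coe_sum]
    exact mul_le_mul_of_nonneg_left (Finset.sum_le_sum fun m _ => (h m).2)
      (by exact_mod_cast (by positivity : (0 : ℝ) ≤ (M : ℝ)⁻¹))
  refine le_trans ?_ (EReal.sub_le_sub le_rfl h1)
  rw [← EReal.coe_sub]
  exact le_rfl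

/-- Where the dual objective is not `-∞`, the values of the perspective at the scenarios are
optimal epigraph variables. -/
theorem exists_obj_eq_dualObj_empLaw (hφ : IsDivergenceGenerator φ) (hM : 0 < M) (z : Fin M → Z)
    (f : Z → ℝ) {ρ η ν : ℝ} (hη : 0 ≤ η) (hbot : dualObj φ (empLaw z) ρ f η ν ≠ ⊥) :
    ∃ u, (η, ν, u) ∈ (dualConic φ ρ fun m => f (z m)).feasible ∧
      (((dualConic φ ρ fun m => f (z m)).obj (η, ν, u) : ℝ) : EReal) =
        dualObj φ (empLaw z) ρ f η ν := by
  rw [dualObj_empLaw hφ hM z f ρ ν hη] at hbot ⊢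
  have hfin : ∀ m, conjPersp φ η (ν - f (z m)) ≠ ⊤ := by
    intro m hm
    apply hbot
    have hsum : ∑ m, conjPersp φ η (ν - f (z m)) = ⊤ :=
      EReal.sum_eq_top (fun m _ => conjPersp_ne_bot hφ hη _) (Finset.mem_univ m) hm
    rw [hsum, EReal.coe_mul_top_of_pos (by positivity), EReal.sub_top]
  have hreal : ∀ m, ((conjPersp φ η (ν - f (z m))).toReal : EReal) = conjPersp φ η (ν - f (z m)) :=
    fun m => EReal.coe_toReal (hfin m) (conjPersp_ne_bot hφ hη _)
  refine ⟨fun m => (conjPersp φ η (ν - f (z m))).toReal,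
    mem_feasible_dualConic.2 fun m => ⟨hη, (hreal m).ge⟩, ?_⟩
  rw [← Finset.sum_congr rfl fun m _ => hreal m, ← EReal.coe_sum, ← EReal.coe_mul, ← EReal.coe_sub]
  rfl

theorem dualObj_empLaw_eq_iSup (hφ : IsDivergenceGenerator φ) (hM : 0 < M) (z : Fin M → Z)
    (f : Z → ℝ) (ρ : ℝ) {η : ℝ} (ν : ℝ) (hη : 0 ≤ η) :
    dualObj φ (empLaw z) ρ f η ν =
      ⨆ (u : Fin M → ℝ) (_ : (η, ν, u) ∈ (dualConic φ ρ fun m => f (z m)).feasible),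
        (((dualConic φ ρ fun m => f (z m)).obj (η, ν, u) : ℝ) : EReal) := by
  refine le_antisymm ?_ (iSup₂_le fun u hu => obj_le_dualObj_empLaw hφ hM z f hu)
  by_cases hbot : dualObj φ (empLaw z) ρ f η ν = ⊥
  · simp [hbot]
  · obtain ⟨u, hu, h⟩ := exists_obj_eq_dualObj_empLaw hφ hM z f hη hbot
    exact h ▸ le_iSup₂ (f := fun (u : Fin M → ℝ)
      (_ : (η, ν, u) ∈ (dualConic φ ρ fun m => f (z m)).feasible) =>
        (((dualConic φ ρ fun m => f (z m)).obj (η, ν, u) : ℝ) : EReal)) u hu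

/-- The worst case under an empirical law is at least the smallest scenario loss, which is the dual
objective at `η = 0`. -/
theorem worstCase_empLaw_ne_bot (hφ : IsDivergenceGenerator φ) (hM : 0 < M) (z : Fin M → Z)
    {f : Z → ℝ} (hf : Measurable f) (ρ : ℝ) : worstCase φ (empLaw z) ρ f ≠ ⊥ := by
  have := isProbabilityMeasure_empLaw hM z
  obtain ⟨ν, hν⟩ : ∃ ν : ℝ, ∀ m, ν ≤ f (z m) := by
    obtain ⟨ν, hν⟩ := (Set.finite_range fun m => f (z m)).bddBelow
    exact ⟨ν, fun m => hν ⟨m, rfl⟩⟩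
  have h1 := dualObj_le_worstCase (ρ := ρ) (ν := ν) hφ hf (integrable_empLaw hM z f) le_rfl
  have h2 : dualObj φ (empLaw z) ρ f 0 ν = (ν : EReal) := by
    rw [dualObj_empLaw hφ hM z f ρ ν le_rfl]
    simp [conjPersp, hν]
  rw [h2] at h1
  exact ne_bot_of_le_ne_bot (EReal.coe_ne_bot ν) h1

theorem isGreatest_dualConic (hφ : IsDivergenceGenerator φ) (hM : 0 < M) (z : Fin M → Z)
    {f : Z → ℝ} (hf : Measurable f) {ρ : ℝ} (hρ : 0 < ρ) :
    IsGreatest ((fun y => (((dualConic φ ρ fun m => f (z m)).obj y : ℝ) : EReal)) ''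
      (dualConic φ ρ fun m => f (z m)).feasible) (worstCase φ (empLaw z) ρ f) := by
  have := isProbabilityMeasure_empLaw hM z
  have hfi := integrable_empLaw hM z f
  refine ⟨?_, ?_⟩
  · obtain ⟨⟨η, ν⟩, hη, h⟩ := (isGreatest_dualObj hφ hf hfi hρ).1
    simp only at h
    obtain ⟨u, hu, hobj⟩ := exists_obj_eq_dualObj_empLaw hφ hM z f hη
      (h ▸ worstCase_empLaw_ne_bot hφ hM z hf ρ)
    exact ⟨(η, ν, u), hu, hobj.trans h⟩
  · rintro _ ⟨⟨η, ν, u⟩, hu, rfl⟩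
    exact (obj_le_dualObj_empLaw hφ hM z f hu).trans
      (dualObj_le_worstCase hφ hf hfi (mem_feasible_dualConic.1 hu ⟨0, hM⟩).1)

theorem mem_feasible_portfolioConic {n d : ℕ} {γ : Fin n → ℝ}
    {δ : Fin n → EuclideanSpace ℝ (Fin d)} {ρ : ℝ} {z : Fin M → EuclideanSpace ℝ (Fin d)}
    {x : Fin n → ℝ} {w : ℝ × ℝ × (Fin M → ℝ)} :
    (x, w) ∈ (portfolioConic γ δ φ ρ z).feasible ↔
      x ∈ stdSimplex ℝ (Fin n) ∧ w ∈ (dualConic φ ρ fun m => linLoss γ δ x (z m)).feasible := by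
  obtain ⟨η, ν, u⟩ := w
  have hA : (portfolioConic γ δ φ ρ z).A (x, η, ν, u) + (portfolioConic γ δ φ ρ z).b =
      (x, ∑ i, x i - 1, fun m => (ν - linLoss γ δ x (z m), η, u m)) := by
    change (x + 0, ∑ i, x i + -1, (fun m => (ν - linLoss γ δ x (z m), η, u m)) + 0) = _
    rw [add_zero, add_zero, ← sub_eq_add_neg]
  change (portfolioConic γ δ φ ρ z).A (x, η, ν, u) + (portfolioConic γ δ φ ρ z).b ∈
    portfolioCone φ n M ↔ _
  rw [hA, mem_feasible_dualConic]
  change (∀ i, 0 ≤ x i) ∧ ∑ i, x i - 1 = 0 ∧ (∀ m, _) ↔ ((∀ i, 0 ≤ x i) ∧ ∑ i, x i = 1) ∧ _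
  rw [sub_eq_zero, and_assoc]
  rfl

end Conic

theorem measurable_linLoss {n d : ℕ} (γ : Fin n → ℝ) (δ : Fin n → EuclideanSpace ℝ (Fin d))
    (x : Fin n → ℝ) : Measurable (linLoss γ δ x) := by
  have : Continuous (linLoss γ δ x) := by
    unfold linLoss
    fun_prop
  exact this.measurable

theorem theorem2 {n d : ℕ} (γ : Fin n → ℝ) (δ : Fin n → EuclideanSpace ℝ (Fin d))
    (φ : ℝ → ℝ) (hφ : IsDivergenceGenerator φ) (ρ : ℝ) (hρ : 0 < ρ) :
    -- strong duality with dual attainment, for a general reference law and a fixed portfolio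
    (∀ (P : Measure (EuclideanSpace ℝ (Fin d))) [IsProbabilityMeasure P],
      ∀ x ∈ stdSimplex ℝ (Fin n), Integrable (linLoss γ δ x) P →
        IsGreatest
          ((fun p : ℝ × ℝ => dualObj φ P ρ (linLoss γ δ x) p.1 p.2) '' {p | 0 ≤ p.1})
          (worstCase φ P ρ (linLoss γ δ x))) ∧
    -- the case of `M` points of equal mass
    (∀ (M : ℕ) (_ : 0 < M) (z : Fin M → EuclideanSpace ℝ (Fin d)),
      (∀ x ∈ stdSimplex ℝ (Fin n),
        -- the dual objective is a finite sum
        (∀ η ν : ℝ, 0 ≤ η →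
          dualObj φ (empLaw z) ρ (linLoss γ δ x) η ν =
            ((ν - ρ * η : ℝ) : EReal) -
              (((M : ℝ)⁻¹ : ℝ) : EReal) * ∑ m, conjPersp φ η (ν - linLoss γ δ x (z m))) ∧
        -- eliminating the epigraph variables of the conic program leaves the dual objective
        (∀ η ν : ℝ, 0 ≤ η →
          dualObj φ (empLaw z) ρ (linLoss γ δ x) η ν =
            ⨆ (u : Fin M → ℝ)
              (_ : (η, ν, u) ∈ (dualConic φ ρ fun m => linLoss γ δ x (z m)).feasible),
              (((dualConic φ ρ fun m => linLoss γ δ x (z m)).obj (η, ν, u) : ℝ) : EReal)) ∧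
        -- the worst-case expectation is the attained optimal value of the conic program
        IsGreatest
          ((fun y => (((dualConic φ ρ fun m => linLoss γ δ x (z m)).obj y : ℝ) : EReal)) ''
            (dualConic φ ρ fun m => linLoss γ δ x (z m)).feasible)
          (worstCase φ (empLaw z) ρ (linLoss γ δ x))) ∧
      -- the robust portfolio problem as a conic program in `x` and the additional variables
      (⨆ x ∈ stdSimplex ℝ (Fin n), worstCase φ (empLaw z) ρ (linLoss γ δ x)) =
        (portfolioConic γ δ φ ρ z).value) := by
  refine ⟨fun P _ x _ hfi => isGreatest_dualObj hφ (measurable_linLoss γ δ x) hfi hρ,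
    fun M hM z => ⟨fun x _ => ⟨fun η ν hη => dualObj_empLaw hφ hM z _ ρ ν hη,
      fun η ν hη => dualObj_empLaw_eq_iSup hφ hM z _ ρ ν hη,
      isGreatest_dualConic hφ hM z (measurable_linLoss γ δ x) hρ⟩, ?_⟩⟩
  have hval : ∀ x, worstCase φ (empLaw z) ρ (linLoss γ δ x) =
      ⨆ y ∈ (dualConic φ ρ fun m => linLoss γ δ x (z m)).feasible,
        (((dualConic φ ρ fun m => linLoss γ δ x (z m)).obj y : ℝ) : EReal) := by
    intro x
    rw [← (isGreatest_dualConic hφ hM z (measurable_linLoss γ δ x) hρ).isLUB.sSup_eq, sSup_image]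
  simp only [hval]
  rw [ConicProgram.value]
  refine le_antisymm (iSup₂_le fun x hx => iSup₂_le fun w hw => ?_) (iSup₂_le ?_)
  · exact le_iSup₂_of_le (x, w) (mem_feasible_portfolioConic.2 ⟨hx, hw⟩) le_rfl
  · rintro ⟨x, w⟩ hy
    obtain ⟨hx, hw⟩ := mem_feasible_portfolioConic.1 hy
    exact le_iSup₂_of_le x hx (le_iSup₂_of_le w hw le_rfl)
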